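/- Let $x_1,x_2,\dots$ be countably many commuting indeterminates. For $k\ge 0$ let $e_k=\sum_{1\le i_1<\dots<i_k}x_{i_1}\cdots x_{i_k}$, and for a partition $\lambda=(\lambda_1,\dots,\lambda_l)$ let $e_\lambda=e_{\lambda_1}\cdots e_{\lambda_l}$. The chromatic symmetric function of a finite graph $G$ is $X_G=\sum_\kappa\prod_{v\in V(G)}x_{\kappa(v)}$, where $\kappa$ runs over all proper colorings of $G$ by positive integers. A graph $G$ with $n$ vertices is called $e$-positive if, in the expansion $X_G=\sum_{\lambda\vdash n}c_\lambda e_\lambda$ with $c_\lambda\in\mathbb{Q}$, all coefficients $c_\lambda$ are nonnegative. For integers $m\ge 2$ and $a,b\ge 0$, let $n=a+m+b$, and let the hat $H_{a,m,b}$ be the graph obtained from the path $P_n=v_1v_2\cdots v_n$ by adding the edge $v_{a+1}v_{a+m}$ (for $m=2$ this repeats an edge of the path, which does not affect proper colorings). **Theorem.** Every hat is $e$-positive: for all integers $m\ge 2$ and $a,b\ge 0$, the hat $H_{a,m,b}$ is $e$-positive. -/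

import Mathlib

/-- The formal sum `∑ i, x ^ (m i)` of a family of monomials in the countably many indeterminates
`x_0, x_1, x_2, …`, as a formal power series over `ℚ`: the coefficient of `x ^ d` is the number of
indices `i` with `m i = d`. It is meaningful when each monomial occurs only finitely often. -/
noncomputable def monomialSum {ι : Type*} (m : ι → (ℕ →₀ ℕ)) : MvPowerSeries ℕ ℚ :=
  fun d => (Nat.card {i : ι // m i = d} : ℚ)

/-- The monomial `∏ i ∈ s, x_i` as an exponent vector. -/
noncomputable def subsetMonomial (s : Finset ℕ) : ℕ →₀ ℕ :=
  ∑ i ∈ s, Finsupp.single i 1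

/-- The elementary symmetric function `e_k = ∑_{i_1 < ⋯ < i_k} x_{i_1} ⋯ x_{i_k}`. -/
noncomputable def elemSymm (k : ℕ) : MvPowerSeries ℕ ℚ :=
  monomialSum (fun s : {s : Finset ℕ // s.card = k} => subsetMonomial s.1)

/-- `e_lam = e_{lam_1} ⋯ e_{lam_l}` for a partition `lam = (lam_1, …, lam_l)`. -/
noncomputable def elemSymmPart {n : ℕ} (lam : n.Partition) : MvPowerSeries ℕ ℚ :=
  (lam.parts.map elemSymm).prod

/-- The monomial `∏_v x_{κ v}` of a proper colouring `κ`, as an exponent vector. -/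
noncomputable def coloringMonomial {V : Type*} [Fintype V] {G : SimpleGraph V}
    (κ : G.Coloring ℕ) : ℕ →₀ ℕ :=
  ∑ v, Finsupp.single (κ v) 1

/-- The chromatic symmetric function `X_G = ∑_κ ∏_v x_{κ v}`, where `κ` runs over all proper
colourings of `G` by the countably many colours `0, 1, 2, …`. -/
noncomputable def chromaticSymm {V : Type*} [Fintype V] (G : SimpleGraph V) :
    MvPowerSeries ℕ ℚ :=
  monomialSum (fun κ : G.Coloring ℕ => coloringMonomial κ)

/-- A symmetric function `f`, homogeneous of degree `n`, is `e`-positive if the coefficients of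
its expansion in the basis `(e_lam)`, `lam ⊢ n`, are all nonnegative. -/
def IsEPositive (n : ℕ) (f : MvPowerSeries ℕ ℚ) : Prop :=
  ∃ c : n.Partition → ℚ, f = ∑ lam, c lam • elemSymmPart lam ∧ ∀ lam, 0 ≤ c lam

/-- A finite graph is `e`-positive if its chromatic symmetric function is. -/
def SimpleGraph.IsEPositive {V : Type*} [Fintype V] (G : SimpleGraph V) : Prop :=
  _root_.IsEPositive (Fintype.card V) (chromaticSymm G)

/-- The hat `H_{a,m,b}`: the path `v_1 ⋯ v_n`, `n = a + m + b`, with the extra edge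
`v_{a+1} v_{a+m}`; here the vertex `v_i` is the element `i - 1` of `Fin n`. For `m = 2` the extra
edge repeats an edge of the path, which does not affect proper colourings. -/
def hat (a m b : ℕ) (hm : 2 ≤ m) : SimpleGraph (Fin (a + m + b)) :=
  SimpleGraph.pathGraph (a + m + b) ⊔
    SimpleGraph.edge ⟨a, by omega⟩ ⟨a + m - 1, by omega⟩

/-- The formal sum defining `e_k` has finitely many terms for each monomial. -/
theorem finite_subsetMonomial_fiber (k : ℕ) (d : ℕ →₀ ℕ) :
    Finite {s : {s : Finset ℕ // s.card = k} // subsetMonomial s.1 = d} := by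
  have hs : ∀ s : Finset ℕ, (subsetMonomial s).support = s := by
    intro s
    ext j
    simp [subsetMonomial, Finsupp.finsetSum_apply, Finsupp.single_apply]
  refine @Finite.of_subsingleton _ ⟨?_⟩
  rintro ⟨⟨s, h1⟩, h2⟩ ⟨⟨t, h3⟩, h4⟩
  have : s = t := by rw [← hs s, ← hs t]; exact congrArg _ (h2.trans h4.symm)
  subst this
  rfl

/-- The formal sum defining `X_G` has finitely many terms for each monomial. -/
theorem finite_coloringMonomial_fiber {V : Type*} [Fintype V] (G : SimpleGraph V)
    (d : ℕ →₀ ℕ) : Finite {κ : G.Coloring ℕ // coloringMonomial κ = d} := by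
  have key : ∀ κ : {κ : G.Coloring ℕ // coloringMonomial κ = d}, ∀ v, κ.1 v ∈ d.support := by
    rintro ⟨κ, rfl⟩ v
    rw [Finsupp.mem_support_iff]
    change (∑ w, Finsupp.single (κ w) 1 : ℕ →₀ ℕ) (κ v) ≠ 0
    rw [Finsupp.finsetSum_apply]
    intro h
    have := (Finset.sum_eq_zero_iff.mp h) v (Finset.mem_univ v)
    simp at this
  refine Finite.of_injective
    (fun κ : {κ : G.Coloring ℕ // coloringMonomial κ = d} =>
      fun v => (⟨κ.1 v, key κ v⟩ : d.support)) ?_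
  intro κ κ' h
  apply Subtype.ext
  apply RelHom.ext
  intro v
  exact congrArg Subtype.val (congrFun h v)

/-! Write E = ∑ e_k z^k, θ = z d/dz, D = E - θE, and P = ∑ P_n z^n for the path generating function.
Transfer sums give P D = E. Since 1 - D has coefficients (n - 1) e_n for n ≥ 1 and constant term 0,
the series 1/D is e-positive. Triple deletion on a triangle relates hats to shorter-tailed hats,
paths and three-legged spiders, and spiders reduce to products of paths. Solving these relations
(`hat_eq_coeff`) exhibits the hat as a coefficient of N/D (`pathDenom_mul_hatSeries`), where N = (θ
- (a+b+1))(D T) + (θ - (a+b+2))(W D T) + ((a+b+1) - θ)(W') E, T is the part of P beyond degree b,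
and W, W' are the parts of P in degrees (0, a] and (b, b+a]. In degrees n ≥ a+b+2 every term of N is
e-positive, because D T is and θ multiplies by n. In lower degrees signs are mixed, but there N
vanishes altogether (`coeff_numerator_of_le`). Hence N, and with it N/D, is e-positive. All this is
done with finitely many colours, uniformly in the set of colours. A coefficient of X_G at a monomial
involves only the colours in its support, so the expansion passes to infinitely many indeterminates.
-/

open Finset

/-! ### Weighted colouring counts of paths, spiders and hats, and their relations -/

section TransferSums

/-- The indicator of `c ≠ d`. -/
def neInd (A : Type*) [CommRing A] {C : Type*} [DecidableEq C] (c d : C) : A :=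
  if c = d then 0 else 1

section

variable {C A : Type*} [DecidableEq C] [CommRing A]

theorem neInd_comm (c d : C) : neInd A c d = neInd A d c := by
  simp only [neInd, eq_comm]

/-- Source of triple deletion: if c = d the difference is already zero, and otherwise the factor is
1. -/
theorem neInd_triangle (c d v : C) :
    neInd A c d * (neInd A d v - neInd A c v) = neInd A d v - neInd A c v := by
  unfold neInd
  by_cases h : c = d
  · subst h; simp
  · simp [h]

end

variable {C A : Type*} [Fintype C] [DecidableEq C] [CommRing A]

theorem sum_neInd_mul (c : C) (f : C → A) :
    ∑ d, neInd A c d * f d = ∑ d, f d - f c := by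
  have : ∀ d, neInd A c d * f d = f d - if c = d then f d else 0 := by
    intro d; unfold neInd; split_ifs <;> simp
  simp [this, sum_sub_distrib]

/-- The weighted number of proper colourings of a path on `n` vertices
whose first vertex is not coloured `c`. -/
def pathAvoid (x : C → A) : ℕ → C → A
  | 0, _ => 1
  | n + 1, c => ∑ d, neInd A c d * (x d * pathAvoid x n d)

/-- The weighted number of proper colourings of a path on `n` vertices. -/
def pathSum (x : C → A) : ℕ → A
  | 0 => 1
  | n + 1 => ∑ d, x d * pathAvoid x n d

/-- The weighted number of proper colourings of a spider with three legs. -/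
def spiderSum (x : C → A) (a b c : ℕ) : A :=
  ∑ v, x v * pathAvoid x a v * pathAvoid x b v * pathAvoid x c v

/-- The weighted number of colourings of `k` consecutive vertices inserted properly between
neighbours coloured `c` and `d`. -/
def between (x : C → A) : ℕ → C → C → A
  | 0, c, d => neInd A c d
  | k + 1, c, d => ∑ v, neInd A c v * (x v * between x k v d)

/-- The weighted number of proper colourings of the hat `H_{a,k+2,b}`. -/
def hatSum (x : C → A) (a k b : ℕ) : A :=
  ∑ c, ∑ d, neInd A c d * (x c * x d * pathAvoid x a c * pathAvoid x b d * between x k c d)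

variable (x : C → A)

theorem pathAvoid_succ (n : ℕ) (c : C) :
    pathAvoid x (n + 1) c = pathSum x (n + 1) - x c * pathAvoid x n c := by
  rw [pathAvoid, sum_neInd_mul, pathSum]

theorem between_succ (k : ℕ) (c d : C) :
    between x (k + 1) c d = ∑ v, neInd A c v * (x v * between x k v d) := rfl

theorem between_succ_right (k : ℕ) (c d : C) :
    between x (k + 1) c d = ∑ v, between x k c v * (x v * neInd A v d) := by
  induction k generalizing c with
  | zero => simp [between]
  | succ k ih =>
    rw [between_succ]
    simp_rw [ih, between_succ x k c, mul_sum, sum_mul]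
    rw [sum_comm]
    refine sum_congr rfl fun v _ => sum_congr rfl fun w _ => ?_
    ring

theorem between_comm (k : ℕ) (c d : C) : between x k c d = between x k d c := by
  induction k generalizing c d with
  | zero => exact neInd_comm c d
  | succ k ih =>
    rw [between, between_succ_right]
    refine sum_congr rfl fun v _ => ?_
    rw [ih v d, neInd_comm c v]
    ring

theorem sum_mul_between (k : ℕ) (c : C) :
    ∑ d, x d * between x k d c = pathAvoid x (k + 1) c := by
  induction k generalizing c with
  | zero => simp [between, pathAvoid, neInd_comm c, mul_comm]
  | succ k ih =>
    rw [pathAvoid]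
    simp only [between_succ_right x k, ← ih, mul_sum]
    rw [sum_comm]
    refine sum_congr rfl fun v _ => sum_congr rfl fun w _ => ?_
    rw [neInd_comm c v]
    ring

theorem spiderSum_zero (a c : ℕ) : spiderSum x a 0 c = pathSum x (a + c + 1) := by
  induction c generalizing a with
  | zero => simp [spiderSum, pathSum, pathAvoid]
  | succ c ih =>
    rw [show a + (c + 1) + 1 = a + 1 + c + 1 by ring, ← ih]
    simp only [spiderSum, pathAvoid, mul_sum, sum_mul]
    rw [sum_comm]
    refine sum_congr rfl fun v _ => sum_congr rfl fun w _ => ?_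
    rw [neInd_comm w v]
    ring

/-- By `pathAvoid_succ`, lengthening either leg yields a product of two paths minus the same sum ∑
x_v² R_a R_b R_c, where R_n is `pathAvoid x n v`; this sum cancels in the difference. -/
theorem spiderSum_succ (a b c : ℕ) : spiderSum x a (b + 1) c =
    spiderSum x (a + 1) b c + pathSum x (b + 1) * pathSum x (a + c + 1)
      - pathSum x (a + 1) * pathSum x (b + 1 + c) := by
  rw [show b + 1 + c = b + c + 1 by ring, ← spiderSum_zero, ← spiderSum_zero]
  simp only [spiderSum, pathAvoid_succ, mul_sum, ← sum_add_distrib, ← sum_sub_distrib]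
  refine sum_congr rfl fun v _ => ?_
  simp only [pathAvoid]
  ring

theorem hatSum_comm (a k b : ℕ) : hatSum x a k b = hatSum x b k a := by
  rw [hatSum, sum_comm]
  refine sum_congr rfl fun c _ => sum_congr rfl fun d _ => ?_
  rw [between_comm, neInd_comm]
  ring

theorem hatSum_zero_zero (b : ℕ) : hatSum x 0 0 b = pathSum x (b + 2) := by
  rw [pathSum]
  simp only [hatSum, pathAvoid, between, mul_sum]
  refine sum_congr rfl fun v _ => sum_congr rfl fun w _ => ?_
  unfold neInd
  split_ifs <;> simp [mul_assoc]

/-- Let d, v be the ends of the extra edge and c the tail vertex next to d. The four terms carry the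
same weight w and differ only in which edges of the triangle c, d, v are imposed: {cd, dv}, {cd,
cv}, {dv} and {cv}. The last is a spider centred at v. -/
theorem hatSum_succ (a k b : ℕ) : hatSum x (a + 1) k b =
    hatSum x a (k + 1) b + pathSum x (a + 1) * hatSum x 0 k b - spiderSum x b (a + 1) (k + 1) := by
  set w : C → C → C → A := fun c d v =>
    x c * x d * x v * pathAvoid x a c * pathAvoid x b v * between x k d v with hw
  have h1 : hatSum x (a + 1) k b = ∑ c, ∑ d, ∑ v, neInd A c d * neInd A d v * w c d v := by
    rw [sum_comm]
    refine sum_congr rfl fun d _ => ?_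
    rw [sum_comm]
    refine sum_congr rfl fun v _ => ?_
    simp only [pathAvoid, mul_sum, sum_mul]
    refine sum_congr rfl fun c _ => ?_
    rw [neInd_comm d c]
    ring
  have h2 : hatSum x a (k + 1) b = ∑ c, ∑ d, ∑ v, neInd A c d * neInd A c v * w c d v := by
    refine sum_congr rfl fun c _ => ?_
    rw [sum_comm]
    refine sum_congr rfl fun v _ => ?_
    simp only [between_succ, mul_sum]
    refine sum_congr rfl fun d _ => ?_
    ring
  have h3 : pathSum x (a + 1) * hatSum x 0 k b = ∑ c, ∑ d, ∑ v, neInd A d v * w c d v := by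
    rw [pathSum, hatSum, sum_mul]
    simp only [mul_sum]
    refine sum_congr rfl fun c _ => sum_congr rfl fun d _ => sum_congr rfl fun v _ => ?_
    simp only [pathAvoid, hw]
    ring
  have h4 : spiderSum x b (a + 1) (k + 1) = ∑ c, ∑ d, ∑ v, neInd A c v * w c d v := by
    simp_rw [sum_comm (γ := C) (s := univ) (t := univ) (f := fun d v => neInd A _ v * w _ d v)]
    rw [sum_comm]
    refine sum_congr rfl fun v _ => ?_
    rw [← sum_mul_between x k, pathAvoid]
    simp only [mul_sum, sum_mul]
    rw [sum_comm]
    refine sum_congr rfl fun c _ => sum_congr rfl fun d _ => ?_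
    rw [neInd_comm v c]
    ring
  rw [h1, h2, h3, h4]
  simp only [← sum_add_distrib, ← sum_sub_distrib]
  refine sum_congr rfl fun c _ => sum_congr rfl fun d _ => sum_congr rfl fun v _ => ?_
  linear_combination w c d v * neInd_triangle (A := A) c d v

open PowerSeries in
/-- The Euler operator `z d/dz` on power series. -/
noncomputable def euler (f : PowerSeries A) : PowerSeries A := X * d⁄dX A f

theorem coeff_euler (f : PowerSeries A) (n : ℕ) :
    PowerSeries.coeff n (euler f) = n * PowerSeries.coeff n f := by
  cases n with
  | zero => simp [euler]
  | succ n =>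
    rw [euler, PowerSeries.coeff_succ_X_mul, PowerSeries.coeff_derivative]
    push_cast
    ring

theorem euler_mul (f g : PowerSeries A) : euler (f * g) = euler f * g + f * euler g := by
  simp only [euler, Derivation.leibniz, smul_eq_mul]
  ring

-- With R_c the series of `pathAvoid`, one has P = (1 + x_c z) R_c and P = 1 + z ∑ x_c R_c. The
-- logarithmic derivative of E = ∏ (1 + x_c z) then gives θE · P = E (P - 1).
open PowerSeries in
theorem pathSeries_mul : PowerSeries.mk (pathSum x) * ((∏ c, (1 + PowerSeries.C (x c) * X)) -
    euler (∏ c, (1 + PowerSeries.C (x c) * X))) = ∏ c, (1 + PowerSeries.C (x c) * X) := by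
  have hR : ∀ c, PowerSeries.mk (fun n => pathAvoid x n c) * (1 + PowerSeries.C (x c) * X) =
      PowerSeries.mk (pathSum x) := by
    intro c
    ext n
    rw [mul_add, mul_one, mul_left_comm]
    cases n with
    | zero => simp [pathAvoid, pathSum]
    | succ n =>
      rw [map_add, coeff_C_mul, coeff_succ_mul_X, coeff_mk, coeff_mk, coeff_mk, pathAvoid_succ]
      ring
  have hP : PowerSeries.mk (pathSum x) =
      1 + X * ∑ c, PowerSeries.C (x c) * PowerSeries.mk (fun n => pathAvoid x n c) := by
    ext n
    cases n with
    | zero => simp [pathSum]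
    | succ n => simp [pathSum, coeff_succ_X_mul, coeff_one]
  have hE : ∀ s : Finset C, euler (∏ c ∈ s, (1 + PowerSeries.C (x c) * X)) *
      PowerSeries.mk (pathSum x) = (∏ c ∈ s, (1 + PowerSeries.C (x c) * X)) *
        (X * ∑ c ∈ s, PowerSeries.C (x c) * PowerSeries.mk (fun n => pathAvoid x n c)) := by
    intro s
    induction s using Finset.induction_on with
    | empty => simp [euler]
    | insert c s hc ih =>
      have hθ : euler (1 + PowerSeries.C (x c) * X) = PowerSeries.C (x c) * X := by
        simp [euler, mul_comm]
      rw [prod_insert hc, sum_insert hc, euler_mul, hθ]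
      linear_combination (1 + PowerSeries.C (x c) * X) * ih
        - PowerSeries.C (x c) * X * (∏ c ∈ s, (1 + PowerSeries.C (x c) * X)) * hR c
  linear_combination (∏ c, (1 + PowerSeries.C (x c) * X)) * hP - hE univ

end TransferSums

/-! ### The denominator D = E - θE -/

section PathDenom

variable {A : Type*} [CommRing A] {e : ℕ → A}

/-- The series `E - z E'`, where `E = ∑ e_k z ^ k`. -/
noncomputable def pathDenom (e : ℕ → A) : PowerSeries A :=
  PowerSeries.mk e - euler (PowerSeries.mk e)

theorem coeff_one_sub_pathDenom (h0 : e 0 = 1) (n : ℕ) :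
    PowerSeries.coeff n (1 - pathDenom e) = ((n - 1 : ℕ) : A) * e n := by
  cases n with
  | zero => simp [pathDenom, euler, h0]
  | succ n => simp [pathDenom, coeff_euler, PowerSeries.coeff_one]; ring

end PathDenom

/-! ### The graded cone of e-positive elements -/

section EPositivity

variable {A : Type*} [CommRing A] [Algebra ℚ A]

/-- The cone of nonnegative rational combinations of the products `e_{i_1} ⋯ e_{i_l}` with
positive indices of sum `n`. -/
inductive EPos (e : ℕ → A) : ℕ → A → Prop
  | zero (n : ℕ) : EPos e n 0
  | add {n : ℕ} {f g : A} : EPos e n f → EPos e n g → EPos e n (f + g)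
  | monomial (q : ℚ) (hq : 0 ≤ q) (s : Multiset ℕ) (hs : ∀ i ∈ s, 0 < i) :
      EPos e s.sum (q • (s.map e).prod)

variable {e : ℕ → A}

theorem EPos.exists_partition {n : ℕ} {f : A} (h : EPos e n f) :
    ∃ c : n.Partition → ℚ, f = ∑ lam, c lam • (lam.parts.map e).prod ∧ ∀ lam, 0 ≤ c lam := by
  classical
  induction h with
  | zero n => exact ⟨0, by simp, fun _ => le_rfl⟩
  | add _ _ ih₁ ih₂ =>
    obtain ⟨c₁, h₁, p₁⟩ := ih₁
    obtain ⟨c₂, h₂, p₂⟩ := ih₂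
    refine ⟨c₁ + c₂, ?_, fun lam => add_nonneg (p₁ lam) (p₂ lam)⟩
    rw [h₁, h₂, ← sum_add_distrib]
    exact sum_congr rfl fun lam _ => (add_smul _ _ _).symm
  | monomial q hq s hs =>
    let lam₀ : s.sum.Partition := ⟨s, fun {i} hi => hs i hi, rfl⟩
    refine ⟨Pi.single lam₀ q, ?_, fun lam => ?_⟩
    · rw [sum_eq_single lam₀ (fun lam _ hne => by simp [Pi.single_eq_of_ne hne]) (by simp)]
      simp [lam₀]
    · rw [Pi.single_apply]
      split_ifs
      exacts [hq, le_rfl]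

theorem EPos.one : EPos e 0 1 := by
  simpa using EPos.monomial (e := e) 1 zero_le_one 0 (by simp)

theorem EPos.gen (h0 : e 0 = 1) (k : ℕ) : EPos e k (e k) := by
  rcases Nat.eq_zero_or_pos k with rfl | hk
  · rw [h0]; exact EPos.one
  · simpa using EPos.monomial (e := e) 1 zero_le_one {k} (by simpa using hk)

theorem EPos.mul {m n : ℕ} {f g : A} (hf : EPos e m f) (hg : EPos e n g) :
    EPos e (m + n) (f * g) := by
  induction hf with
  | zero => rw [zero_mul]; exact .zero _
  | add _ _ ih₁ ih₂ => rw [add_mul]; exact ih₁.add ih₂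
  | monomial q hq s hs =>
    induction hg with
    | zero => rw [mul_zero]; exact .zero _
    | add _ _ ih₁ ih₂ => rw [mul_add]; exact ih₁.add ih₂
    | monomial r hr t ht =>
      rw [smul_mul_smul_comm, ← Multiset.prod_add, ← Multiset.map_add, ← Multiset.sum_add]
      refine .monomial _ (mul_nonneg hq hr) _ fun i hi => ?_
      rcases Multiset.mem_add.mp hi with hi | hi
      exacts [hs i hi, ht i hi]

theorem EPos.natCast_mul {n : ℕ} {f : A} (hf : EPos e n f) (k : ℕ) : EPos e n (k * f) := by
  induction k with
  | zero => rw [Nat.cast_zero, zero_mul]; exact .zero _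
  | succ k ih => rw [Nat.cast_succ, add_mul, one_mul]; exact ih.add hf

theorem EPos.sum {ι : Type*} {n : ℕ} (s : Finset ι) {f : ι → A} (hf : ∀ i ∈ s, EPos e n (f i)) :
    EPos e n (∑ i ∈ s, f i) :=
  sum_induction f (EPos e n) (fun _ _ => .add) (.zero n) hf

/-- Every coefficient of the series lies in the cone of the same degree. -/
def SeriesEPos (e : ℕ → A) (f : PowerSeries A) : Prop :=
  ∀ n, EPos e n (PowerSeries.coeff n f)

theorem SeriesEPos.mul {f g : PowerSeries A} (hf : SeriesEPos e f) (hg : SeriesEPos e g) :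
    SeriesEPos e (f * g) := by
  intro n
  rw [PowerSeries.coeff_mul]
  refine EPos.sum _ fun p hp => ?_
  rw [← mem_antidiagonal.mp hp]
  exact (hf p.1).mul (hg p.2)

theorem seriesEPos_one_sub_pathDenom (h0 : e 0 = 1) : SeriesEPos e (1 - pathDenom e) := by
  intro n
  rw [coeff_one_sub_pathDenom h0]
  exact (EPos.gen h0 n).natCast_mul _

/-- Q = 1 + (1 - D) Q with 1 - D e-positive and without constant term, so each coefficient of Q is
built from earlier ones. -/
theorem seriesEPos_of_pathDenom_mul (h0 : e 0 = 1) {Q : PowerSeries A}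
    (hQ : pathDenom e * Q = 1) : SeriesEPos e Q := by
  intro n
  induction n using Nat.strong_induction_on with
  | _ n ih =>
    have h : Q = 1 + (1 - pathDenom e) * Q := by linear_combination hQ
    rw [h, map_add, PowerSeries.coeff_mul]
    refine .add ?_ (EPos.sum _ fun p hp => ?_)
    · rw [PowerSeries.coeff_one]
      split_ifs with hn
      · rw [hn]; exact EPos.one
      · exact .zero _
    · obtain ⟨i, j⟩ := p
      rw [HasAntidiagonal.mem_antidiagonal] at hp
      rcases Nat.eq_zero_or_pos i with rfl | hi
      · rw [coeff_one_sub_pathDenom h0]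
        simpa using EPos.zero n
      · simp only at hp ⊢
        rw [← hp]
        exact (seriesEPos_one_sub_pathDenom h0 i).mul (ih j (by omega))

end EPositivity

/-! ### Solving the relations by generating functions -/

section HatSeries

variable {A : Type*} [CommRing A]

/-- The part of `∑ P_n z ^ n` with exponents in `(b, b + a]`. -/
noncomputable def window (P : ℕ → A) (b a : ℕ) : PowerSeries A :=
  PowerSeries.mk fun n => if b < n ∧ n ≤ b + a then P n else 0

theorem window_zero (P : ℕ → A) (b : ℕ) : window P b 0 = 0 := by
  ext n
  simp only [window, PowerSeries.coeff_mk, map_zero]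
  rw [if_neg (by omega)]

theorem window_succ (P : ℕ → A) (b a : ℕ) : window P b (a + 1) =
    window P b a + PowerSeries.C (P (b + a + 1)) * PowerSeries.X ^ (b + a + 1) := by
  ext n
  simp only [window, PowerSeries.coeff_mk, map_add, PowerSeries.coeff_C_mul_X_pow]
  by_cases h : n = b + a + 1
  · subst h
    rw [if_pos (by omega), if_neg (by omega), if_pos rfl, zero_add]
  · rw [if_neg h, add_zero]
    exact if_congr (by omega) rfl rfl

theorem coeff_window_mul (P : ℕ → A) (b a n : ℕ) (h : b + a ≤ n) (f : PowerSeries A) :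
    PowerSeries.coeff n (window P b a * f) =
      ∑ i ∈ range a, P (b + i + 1) * PowerSeries.coeff (n - (b + i + 1)) f := by
  induction a with
  | zero => simp [window_zero]
  | succ a ih =>
    rw [window_succ, add_mul, map_add, ih (by omega), sum_range_succ, mul_assoc,
      PowerSeries.coeff_C_mul]
    conv_lhs => rw [← Nat.sub_add_cancel (show b + a + 1 ≤ n by omega), PowerSeries.coeff_X_pow_mul]
    rw [Nat.sub_add_cancel (show b + a + 1 ≤ n by omega)]

theorem euler_C_mul_X_pow (p : A) (k : ℕ) :
    euler (PowerSeries.C p * PowerSeries.X ^ k) =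
      (k : PowerSeries A) * (PowerSeries.C p * PowerSeries.X ^ k) := by
  ext n
  rw [coeff_euler, ← map_natCast (PowerSeries.C (R := A))]
  simp only [PowerSeries.coeff_C_mul, PowerSeries.coeff_X_pow]
  split_ifs with h
  · rw [h]
  · simp

/-- The relations between the weighted numbers of colourings of paths, spiders and hats
that determine those of hats; `H a k b` belongs to the hat `H_{a,k+2,b}`. -/
structure HatRelations (e P : ℕ → A) (S H : ℕ → ℕ → ℕ → A) : Prop where
  gen_zero : e 0 = 1
  path : ∀ n, ∑ p ∈ antidiagonal n, P p.1 * ((1 - (p.2 : A)) * e p.2) = e n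
  spider_zero : ∀ a c, S a 0 c = P (a + c + 1)
  spider_succ : ∀ a b c, S a (b + 1) c =
    S (a + 1) b c + P (b + 1) * P (a + c + 1) - P (a + 1) * P (b + 1 + c)
  hat_comm : ∀ a k b, H a k b = H b k a
  hat_zero_zero : ∀ b, H 0 0 b = P (b + 2)
  hat_succ : ∀ a k b, H (a + 1) k b = H a (k + 1) b + P (a + 1) * H 0 k b - S b (a + 1) (k + 1)

/-- The generating function `∑ H_{0,n,0} z ^ n` of cycles. -/
noncomputable def cycleSeries (H : ℕ → ℕ → ℕ → A) : PowerSeries A :=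
  PowerSeries.mk fun n => if 2 ≤ n then H 0 (n - 2) 0 else 0

/-- The part of `∑ P_n z ^ n` with exponents greater than `b`. -/
noncomputable def pathTail (P : ℕ → A) (b : ℕ) : PowerSeries A :=
  PowerSeries.mk P - 1 - window P 0 b

/-- A series whose coefficient of `z ^ (m + b)` is that of the tadpole `H_{0,m,b}`. -/
noncomputable def tadpoleSeries (P : ℕ → A) (H : ℕ → ℕ → ℕ → A) (b : ℕ) : PowerSeries A :=
  euler (pathTail P b) - (b + 1 : PowerSeries A) * pathTail P b - pathTail P b * cycleSeries H

/-- A series whose coefficient of `z ^ (a + m + b)` is that of the hat `H_{a,m,b}`. -/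
noncomputable def hatSeries (P : ℕ → A) (H : ℕ → ℕ → ℕ → A) (a b : ℕ) : PowerSeries A :=
  (1 + window P 0 a) * tadpoleSeries P H b - (a : PowerSeries A) * pathTail P b
    + ((a + b + 1 : PowerSeries A) * window P b a - euler (window P b a)) * PowerSeries.mk P
    - ((a + 1 : PowerSeries A) * window P 0 a - euler (window P 0 a)) * pathTail P b

namespace HatRelations

variable {e P : ℕ → A} {S H : ℕ → ℕ → ℕ → A}

theorem path_zero (h : HatRelations e P S H) : P 0 = 1 := by
  simpa [h.gen_zero] using h.path 0

theorem pathSeries_mul (h : HatRelations e P S H) :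
    PowerSeries.mk P * pathDenom e = PowerSeries.mk e := by
  ext n
  rw [PowerSeries.coeff_mul, PowerSeries.coeff_mk, ← h.path n]
  refine sum_congr rfl fun p _ => ?_
  simp only [pathDenom, map_sub, coeff_euler, PowerSeries.coeff_mk]
  ring

/-- Vertices move one at a time from the second leg to the first until the spider is a path. -/
theorem spider_eq (h : HatRelations e P S H) (a b c : ℕ) : S a b c = P (a + b + c + 1) +
    ((∑ i ∈ range b, P (i + 1) * P (a + b + c - i)) -
      ∑ i ∈ range b, P (a + i + 1) * P (b + c - i)) := by
  induction b generalizing a with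
  | zero => simp [h.spider_zero]
  | succ b ih =>
    rw [h.spider_succ, ih, sum_range_succ, sum_range_succ']
    have h1 : a + (b + 1) + c = a + 1 + b + c := by ring
    have h2 : ∀ i, b + 1 + c - (i + 1) = b + c - i := fun i => by omega
    have h3 : ∀ i, a + (i + 1) + 1 = a + 1 + i + 1 := fun i => by ring
    simp only [h1, h2, h3, Nat.sub_zero, Nat.add_zero]
    rw [show a + 1 + b + c - b = a + c + 1 by omega]
    ring

theorem coeff_pathTail (h : HatRelations e P S H) (b n : ℕ) :
    PowerSeries.coeff n (pathTail P b) = if b < n then P n else 0 := by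
  rcases Nat.eq_zero_or_pos n with rfl | hn
  · simp [pathTail, window, h.path_zero]
  · simp only [pathTail, window, map_sub, PowerSeries.coeff_mk, PowerSeries.coeff_one,
      if_neg hn.ne']
    by_cases hb : b < n
    · rw [if_pos hb, if_neg (by omega)]; ring
    · rw [if_neg hb, if_pos (by omega)]; ring

theorem tadpole_eq (h : HatRelations e P S H) (k b : ℕ) : H 0 k b =
    PowerSeries.coeff (k + 2 + b) ((1 + window P 0 b) * cycleSeries H)
      - b * P (k + 2 + b) := by
  induction b generalizing k with
  | zero => simp [window_zero, cycleSeries]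
  | succ b ih =>
    have h1 : S 0 (b + 1) (k + 1) = P (k + 1 + 2 + b) := by
      rw [h.spider_eq]
      simp only [zero_add, sub_self, add_zero]
      congr 1; ring
    have h2 : PowerSeries.coeff (k + 2 + (b + 1))
        (PowerSeries.C (P (0 + b + 1)) * PowerSeries.X ^ (0 + b + 1) * cycleSeries H) =
        P (b + 1) * H 0 k 0 := by
      rw [mul_assoc, PowerSeries.coeff_C_mul, zero_add, PowerSeries.coeff_X_pow_mul]
      simp [cycleSeries]
    rw [h.hat_comm, h.hat_succ, h.hat_comm, ih, h1, window_succ,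
      ← add_assoc (1 : PowerSeries A), add_mul (1 + window P 0 b) _ (cycleSeries H), map_add, h2,
      show k + 2 + (b + 1) = k + 1 + 2 + b by ring]
    push_cast
    ring

/-- The tadpole with m = 2 is a path, so `tadpole_eq` with k = 0 becomes an equation for cycles in
terms of paths. -/
theorem pathSeries_mul_cycleSeries (h : HatRelations e P S H) :
    PowerSeries.mk P * cycleSeries H = euler (PowerSeries.mk P) - PowerSeries.mk P + 1 := by
  ext n
  match n with
  | 0 => simp [cycleSeries, euler, h.path_zero]
  | 1 =>
    rw [PowerSeries.coeff_mul]
    simp [cycleSeries, coeff_euler, Nat.antidiagonal_succ, PowerSeries.coeff_one]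
  | b + 2 =>
    have h1 := h.tadpole_eq 0 b
    rw [h.hat_zero_zero, zero_add, add_comm 2 b] at h1
    -- The tail starts in degree b + 1 and the cycle series in degree 2, so truncating P at b loses
    -- nothing in degree b + 2.
    have h2 : PowerSeries.coeff (b + 2) (pathTail P b * cycleSeries H) = 0 := by
      rw [PowerSeries.coeff_mul]
      refine sum_eq_zero fun p hp => ?_
      rw [HasAntidiagonal.mem_antidiagonal] at hp
      rw [h.coeff_pathTail, cycleSeries, PowerSeries.coeff_mk]
      by_cases hb : b < p.1
      · rw [if_neg (show ¬ 2 ≤ p.2 by omega), mul_zero]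
      · rw [if_neg hb, zero_mul]
    have h3 : PowerSeries.mk P * cycleSeries H =
        (1 + window P 0 b) * cycleSeries H + pathTail P b * cycleSeries H := by
      rw [pathTail]; ring
    rw [h3, map_add, h2]
    simp only [map_add, map_sub, coeff_euler, PowerSeries.coeff_mk, PowerSeries.coeff_one]
    rw [if_neg (by omega)]
    push_cast
    linear_combination -h1

theorem pathDenom_mul_cycleSeries (h : HatRelations e P S H) :
    pathDenom e * cycleSeries H = - euler (pathDenom e) := by
  have hE : IsUnit (PowerSeries.mk e) := by
    rw [PowerSeries.isUnit_iff_constantCoeff]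
    simp [h.gen_zero]
  have h1 := h.pathSeries_mul
  have h2 := h.pathSeries_mul_cycleSeries
  have h3 : euler (PowerSeries.mk P) * pathDenom e + PowerSeries.mk P * euler (pathDenom e) =
      euler (PowerSeries.mk e) := by rw [← euler_mul, h1]
  have h4 : pathDenom e = PowerSeries.mk e - euler (PowerSeries.mk e) := rfl
  refine hE.mul_left_cancel ?_
  linear_combination (-(pathDenom e * cycleSeries H) - euler (pathDenom e)) * h1 +
    pathDenom e ^ 2 * h2 + pathDenom e * h3 - pathDenom e * h1 + pathDenom e * h4

theorem tadpole_eq_coeff (h : HatRelations e P S H) (k b : ℕ) :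
    H 0 k b = PowerSeries.coeff (k + 2 + b) (tadpoleSeries P H b) := by
  have h1 : (1 + window P 0 b) * cycleSeries H = euler (PowerSeries.mk P) - PowerSeries.mk P + 1
      - pathTail P b * cycleSeries H := by
    rw [← h.pathSeries_mul_cycleSeries, pathTail]; ring
  have h2 : PowerSeries.coeff (k + 2 + b) ((b + 1 : PowerSeries A) * pathTail P b) =
      (b + 1) * P (k + 2 + b) := by
    rw [show (b + 1 : PowerSeries A) = PowerSeries.C (b + 1 : A) by simp, PowerSeries.coeff_C_mul,
      h.coeff_pathTail, if_pos (by omega)]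
  rw [h.tadpole_eq, h1, tadpoleSeries]
  simp only [map_add, map_sub, coeff_euler, PowerSeries.coeff_mk, PowerSeries.coeff_one,
    h.coeff_pathTail, h2]
  rw [if_neg (by omega), if_pos (by omega)]
  ring

theorem hatSeries_succ (a b : ℕ) : hatSeries P H (a + 1) b = hatSeries P H a b
    + PowerSeries.C (P (a + 1)) * (PowerSeries.X ^ (a + 1) * tadpoleSeries P H b) - pathTail P b
    + window P b (a + 1) * PowerSeries.mk P - window P 0 (a + 1) * pathTail P b := by
  have hadd : ∀ f g : PowerSeries A, euler (f + g) = euler f + euler g := by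
    intro f g; simp [euler, mul_add]
  simp only [hatSeries, window_succ, hadd, euler_C_mul_X_pow]
  push_cast
  simp only [zero_add]
  ring

/-- The increment in `hatSeries_succ` is `hat_succ` with the spider expanded by `spider_eq`; its two
sums are the convolutions with the two windows. -/
theorem hat_eq_coeff (h : HatRelations e P S H) (a k b : ℕ) :
    H a k b = PowerSeries.coeff (a + (k + 2) + b) (hatSeries P H a b) := by
  induction a generalizing k with
  | zero =>
    rw [h.tadpole_eq_coeff, zero_add]
    simp [hatSeries, window_zero, euler]
  | succ a ih =>
    rw [h.hat_succ, ih, hatSeries_succ, h.spider_eq]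
    set n := a + 1 + (k + 2) + b with hn
    rw [show a + (k + 1 + 2) + b = n by omega]
    simp only [map_add, map_sub]
    rw [coeff_window_mul P b (a + 1) n (by omega), coeff_window_mul P 0 (a + 1) n (by omega),
      PowerSeries.coeff_C_mul, show n = k + 2 + b + (a + 1) by omega, PowerSeries.coeff_X_pow_mul,
      ← h.tadpole_eq_coeff, h.coeff_pathTail, if_pos (by omega),
      show b + (a + 1) + (k + 1) + 1 = k + 2 + b + (a + 1) by omega]
    have h1 : ∀ i ∈ range (a + 1), P (0 + i + 1) *
        PowerSeries.coeff (k + 2 + b + (a + 1) - (0 + i + 1)) (pathTail P b) =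
        P (i + 1) * P (b + (a + 1) + (k + 1) - i) := by
      intro i hi
      rw [mem_range] at hi
      rw [h.coeff_pathTail, if_pos (by omega), zero_add]
      congr 2; omega
    have h2 : ∀ i ∈ range (a + 1), P (b + i + 1) *
        PowerSeries.coeff (k + 2 + b + (a + 1) - (b + i + 1)) (PowerSeries.mk P) =
        P (b + i + 1) * P (a + 1 + (k + 1) - i) := by
      intro i hi
      rw [PowerSeries.coeff_mk]
      congr 2; omega
    rw [sum_congr rfl h1, sum_congr rfl h2]
    ring

/-- The numerator of `hatSeries` over the denominator `pathDenom`. -/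
noncomputable def numerator (e P : ℕ → A) (a b : ℕ) : PowerSeries A :=
  (euler (pathDenom e * pathTail P b)
      - (a + b + 1 : ℕ) * (pathDenom e * pathTail P b))
    + (euler (window P 0 a * (pathDenom e * pathTail P b))
      - (a + b + 2 : ℕ) * (window P 0 a * (pathDenom e * pathTail P b)))
    + ((a + b + 1 : ℕ) * window P b a - euler (window P b a)) * PowerSeries.mk e

/-- The cycle series enters only through D C = -θD, which turns D θT - D T C into θ(D T). -/
theorem pathDenom_mul_hatSeries (h : HatRelations e P S H) (a b : ℕ) :
    pathDenom e * hatSeries P H a b = numerator e P a b := by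
  have h1 := h.pathSeries_mul
  have h2 := h.pathDenom_mul_cycleSeries
  simp only [hatSeries, tadpoleSeries, numerator, euler_mul]
  push_cast
  linear_combination ((a + b + 1 : PowerSeries A) * window P b a - euler (window P b a)) * h1
    - (1 + window P 0 a) * pathTail P b * h2

theorem coeff_natCast_mul (k n : ℕ) (f : PowerSeries A) :
    PowerSeries.coeff n ((k : PowerSeries A) * f) = k * PowerSeries.coeff n f := by
  rw [← map_natCast (PowerSeries.C (R := A)), PowerSeries.coeff_C_mul]

theorem X_pow_dvd_pathTail (h : HatRelations e P S H) (b : ℕ) :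
    (PowerSeries.X : PowerSeries A) ^ (b + 1) ∣ pathTail P b := by
  rw [PowerSeries.X_pow_dvd_iff]
  intro m hm
  rw [h.coeff_pathTail, if_neg (by omega)]

theorem coeff_numerator_of_le (h : HatRelations e P S H) {a b n : ℕ} (hn : n ≤ a + b + 1) :
    PowerSeries.coeff n (numerator e P a b) = 0 := by
  have hadd : ∀ f g : PowerSeries A, euler (f + g) = euler f + euler g := by
    intro f g; simp [euler, mul_add]
  have hsub : ∀ f g : PowerSeries A, euler (f - g) = euler f - euler g := by
    intro f g; simp [euler, mul_sub]
  -- Substituting W = P - 1 - `pathTail P a` and P D = E splits the numerator into a part from Y and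
  -- a multiple Z E. Both Y and Z are divisible by z^(a+b+2).
  obtain ⟨Y, hY⟩ : ∃ Y, Y = - (pathTail P a * (pathDenom e * pathTail P b)) := ⟨_, rfl⟩
  obtain ⟨Z, hZ⟩ : ∃ Z, Z = ((a + b + 1 : ℕ) * window P b a - euler (window P b a)) -
    ((a + b + 1 : ℕ) * pathTail P b - euler (pathTail P b)) := ⟨_, rfl⟩
  have hD : pathDenom e = PowerSeries.mk e - euler (PowerSeries.mk e) := rfl
  have hnum : numerator e P a b =
      (euler Y - (a + b + 2 : ℕ) * Y) + Z * PowerSeries.mk e := by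
    have h1 : window P 0 a * (pathDenom e * pathTail P b) =
        Y + (PowerSeries.mk e * pathTail P b - pathDenom e * pathTail P b) := by
      rw [hY, pathTail.eq_def P a]
      linear_combination pathTail P b * h.pathSeries_mul
    rw [numerator, h1, hadd, hsub, euler_mul (PowerSeries.mk e), hZ]
    push_cast
    linear_combination pathTail P b * hD
  have hYn : PowerSeries.coeff n Y = 0 := by
    have h1 := mul_dvd_mul (h.X_pow_dvd_pathTail a)
      ((h.X_pow_dvd_pathTail b).mul_left (pathDenom e))
    rw [← pow_add] at h1
    rw [hY]
    exact PowerSeries.X_pow_dvd_iff.mp h1.neg_right n (by omega)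
  have hZn : PowerSeries.coeff n (Z * PowerSeries.mk e) = 0 := by
    have h1 : (PowerSeries.X : PowerSeries A) ^ (a + b + 2) ∣ Z := by
      rw [PowerSeries.X_pow_dvd_iff]
      intro m hm
      rw [hZ]
      simp only [map_sub, coeff_natCast_mul, coeff_euler, h.coeff_pathTail, window,
        PowerSeries.coeff_mk]
      -- Up to degree a + b the window and the tail agree; in degree a + b + 1 the factor (a+b+1) -
      -- m is zero.
      rcases Nat.lt_succ_iff_lt_or_eq.mp hm with hm | rfl
      · rw [if_congr (show b < m ∧ m ≤ b + a ↔ b < m by omega) rfl rfl, sub_self]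
      · simp
    exact PowerSeries.X_pow_dvd_iff.mp (h1.mul_right _) n (by omega)
  rw [hnum, map_add, map_sub, coeff_natCast_mul, coeff_euler, hYn, hZn]
  ring

variable [Algebra ℚ A]

theorem ePos_path (h : HatRelations e P S H) (n : ℕ) : EPos e n (P n) := by
  obtain ⟨Q, hQ⟩ : ∃ Q, pathDenom e * Q = 1 :=
    ⟨_, PowerSeries.mul_invOfUnit (pathDenom e) 1 (by simp [pathDenom, euler, h.gen_zero])⟩
  have hP : PowerSeries.mk P = PowerSeries.mk e * Q := by
    linear_combination Q * h.pathSeries_mul - PowerSeries.mk P * hQ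
  have hE : SeriesEPos e (PowerSeries.mk e) := fun n => by
    rw [PowerSeries.coeff_mk]; exact EPos.gen h.gen_zero n
  have := hE.mul (seriesEPos_of_pathDenom_mul h.gen_zero hQ) n
  rwa [← hP, PowerSeries.coeff_mk] at this

theorem seriesEPos_window (h : HatRelations e P S H) (b a : ℕ) : SeriesEPos e (window P b a) := by
  intro n
  rw [window, PowerSeries.coeff_mk]
  split_ifs
  exacts [h.ePos_path n, .zero n]

theorem seriesEPos_pathDenom_mul_pathTail (h : HatRelations e P S H) (b : ℕ) :
    SeriesEPos e (pathDenom e * pathTail P b) := by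
  intro n
  by_cases hn : n ≤ b
  · rw [PowerSeries.X_pow_dvd_iff.mp ((h.X_pow_dvd_pathTail b).mul_left _) n (by omega)]
    exact .zero n
  · have h1 : pathDenom e * pathTail P b = PowerSeries.mk e + (1 - pathDenom e)
        + (1 - pathDenom e) * window P 0 b - (1 + window P 0 b) := by
      rw [pathTail]
      linear_combination h.pathSeries_mul
    have h2 : PowerSeries.coeff n (1 + window P 0 b) = 0 := by
      simp only [map_add, window, PowerSeries.coeff_mk, PowerSeries.coeff_one]
      rw [if_neg (by omega), if_neg (by omega), add_zero]
    have h3 := seriesEPos_one_sub_pathDenom h.gen_zero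
    rw [h1, map_sub, h2, sub_zero, map_add, map_add, PowerSeries.coeff_mk]
    exact ((EPos.gen h.gen_zero n).add (h3 n)).add (h3.mul (h.seriesEPos_window 0 b) n)

theorem seriesEPos_numerator (h : HatRelations e P S H) (a b : ℕ) :
    SeriesEPos e (numerator e P a b) := by
  intro n
  by_cases hn : n ≤ a + b + 1
  · rw [h.coeff_numerator_of_le hn]
    exact .zero n
  · obtain ⟨k, rfl⟩ : ∃ k, n = a + b + 2 + k := ⟨n - (a + b + 2), by omega⟩
    have h1 : SeriesEPos e ((a + b + 1 : ℕ) * window P b a - euler (window P b a)) := by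
      intro m
      rw [map_sub, coeff_natCast_mul, coeff_euler, ← sub_mul]
      -- The window ends at degree a + b, so the factor is nonnegative wherever the window is
      -- nonzero.
      by_cases hm : m ≤ a + b + 1
      · rw [← Nat.cast_sub hm]
        exact (h.seriesEPos_window b a m).natCast_mul _
      · rw [window, PowerSeries.coeff_mk, if_neg (by omega), mul_zero]
        exact .zero m
    have h2 : SeriesEPos e (PowerSeries.mk e) := fun n => by
      rw [PowerSeries.coeff_mk]; exact EPos.gen h.gen_zero n
    have h3 := h.seriesEPos_pathDenom_mul_pathTail b
    rw [numerator]
    simp only [map_add, map_sub, coeff_natCast_mul, coeff_euler, ← sub_mul]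
    refine .add (.add ?_ ?_) ((h1.mul h2) _)
    · rw [← Nat.cast_sub (by omega)]
      exact (h3 _).natCast_mul _
    · rw [← Nat.cast_sub (by omega)]
      exact (((h.seriesEPos_window 0 a).mul h3) _).natCast_mul _

theorem ePos_hat (h : HatRelations e P S H) (a k b : ℕ) :
    EPos e (a + (k + 2) + b) (H a k b) := by
  obtain ⟨Q, hQ⟩ : ∃ Q, pathDenom e * Q = 1 :=
    ⟨_, PowerSeries.mul_invOfUnit (pathDenom e) 1 (by simp [pathDenom, euler, h.gen_zero])⟩
  have h1 : hatSeries P H a b = Q * numerator e P a b := by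
    linear_combination Q * h.pathDenom_mul_hatSeries a b - hatSeries P H a b * hQ
  rw [h.hat_eq_coeff, h1]
  exact (seriesEPos_of_pathDenom_mul h.gen_zero hQ).mul (h.seriesEPos_numerator a b) _

end HatRelations

end HatSeries

/-! ### Proper colourings of paths as lists -/

section ChainIndicator

variable {C A : Type*} [DecidableEq C] [CommRing A]

/-- The indicator of the lists whose neighbouring entries differ. -/
def chainInd (A : Type*) [CommRing A] {C : Type*} [DecidableEq C] (l : List C) : A :=
  if l.IsChain (· ≠ ·) then 1 else 0

/-- Cutting at a vertex c leaves it in both pieces; this factors the hat into two tails and a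
middle. -/
theorem chainInd_append_cons (l₁ : List C) (c : C) (l₂ : List C) :
    chainInd A (l₁ ++ c :: l₂) = chainInd A (l₁ ++ [c]) * chainInd A (c :: l₂) := by
  simp only [chainInd, List.isChain_split (l₂ := l₂)]
  split_ifs <;> simp_all

theorem chainInd_cons_cons (c d : C) (l : List C) :
    chainInd A (c :: d :: l) = neInd A c d * chainInd A (d :: l) := by
  simp only [chainInd, neInd, List.isChain_cons_cons]
  split_ifs <;> simp_all

end ChainIndicator

/-! ### Identification of the transfer sums with sums over colourings -/

section ListSums

/-- The sum of `F` over all lists of length `n`. -/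
def listSum {C A : Type*} [Fintype C] [AddCommMonoid A] : ℕ → (List C → A) → A
  | 0, F => F []
  | n + 1, F => ∑ c, listSum n fun l => F (c :: l)

variable {C A : Type*} [Fintype C] [CommRing A]

theorem sum_ofFn_eq_listSum (n : ℕ) (F : List C → A) :
    ∑ κ : Fin n → C, F (List.ofFn κ) = listSum n F := by
  induction n generalizing F with
  | zero => simp [listSum]
  | succ n ih =>
    rw [listSum, ← (Fin.consEquiv fun _ => C).sum_comp, Fintype.sum_prod_type]
    refine sum_congr rfl fun c _ => ?_
    rw [← ih]
    refine sum_congr rfl fun κ _ => ?_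
    simp [Fin.consEquiv, List.ofFn_succ]

theorem listSum_congr {n : ℕ} {F G : List C → A} (h : ∀ l, l.length = n → F l = G l) :
    listSum n F = listSum n G := by
  induction n generalizing F G with
  | zero => exact h [] rfl
  | succ n ih => exact sum_congr rfl fun c _ => ih fun l hl => h _ (by simp [hl])

theorem listSum_add (m n : ℕ) (F : List C → A) :
    listSum (m + n) F = listSum m fun l => listSum n fun l' => F (l ++ l') := by
  induction m generalizing F with
  | zero => simp [listSum]
  | succ m ih =>
    rw [Nat.succ_add, listSum, listSum]
    exact sum_congr rfl fun c _ => ih _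

theorem listSum_mul_left (n : ℕ) (a : A) (F : List C → A) :
    listSum n (fun l => a * F l) = a * listSum n F := by
  induction n generalizing F with
  | zero => rfl
  | succ n ih => simp only [listSum, ih, mul_sum]

theorem listSum_mul_right (n : ℕ) (a : A) (F : List C → A) :
    listSum n (fun l => F l * a) = listSum n F * a := by
  simp only [mul_comm _ a, listSum_mul_left]

theorem listSum_sum {ι : Type*} (n : ℕ) (s : Finset ι) (F : ι → List C → A) :
    listSum n (fun l => ∑ i ∈ s, F i l) = ∑ i ∈ s, listSum n (F i) := by
  induction n generalizing F with
  | zero => rfl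
  | succ n ih => simp only [listSum, ih]; exact sum_comm

variable [DecidableEq C]

variable (x : C → A)

theorem listSum_chainInd_cons (n : ℕ) (c : C) :
    listSum n (fun l => chainInd A (c :: l) * (l.map x).prod) = pathAvoid x n c := by
  induction n generalizing c with
  | zero => simp [listSum, chainInd, pathAvoid]
  | succ n ih =>
    rw [listSum, pathAvoid]
    refine sum_congr rfl fun d _ => ?_
    rw [← ih, ← listSum_mul_left, ← listSum_mul_left]
    refine listSum_congr fun l _ => ?_
    rw [chainInd_cons_cons, List.map_cons, List.prod_cons]
    ring

theorem listSum_chainInd_append (n : ℕ) (c : C) :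
    listSum n (fun l => chainInd A (l ++ [c]) * (l.map x).prod) = pathAvoid x n c := by
  induction n generalizing c with
  | zero => simp [listSum, chainInd, pathAvoid]
  | succ n ih =>
    rw [listSum_add, pathAvoid]
    simp only [listSum]
    rw [listSum_sum]
    refine sum_congr rfl fun d _ => ?_
    rw [← ih, ← listSum_mul_left, ← listSum_mul_left]
    refine listSum_congr fun l _ => ?_
    rw [List.append_assoc, List.singleton_append, chainInd_append_cons, chainInd_cons_cons,
      neInd_comm d c, show chainInd A [c] = 1 by simp [chainInd], List.map_append,
      List.prod_append, List.map_singleton, List.prod_singleton]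
    ring

theorem listSum_chainInd_between (k : ℕ) (c d : C) :
    listSum k (fun l => chainInd A (c :: (l ++ [d])) * (l.map x).prod) = between x k c d := by
  induction k generalizing c with
  | zero => simp [listSum, chainInd, between, neInd, ite_not]
  | succ k ih =>
    rw [listSum, between]
    refine sum_congr rfl fun v _ => ?_
    rw [← ih, ← listSum_mul_left, ← listSum_mul_left]
    refine listSum_congr fun l _ => ?_
    rw [List.cons_append, chainInd_cons_cons, List.map_cons, List.prod_cons]
    ring

theorem listSum_hat (a k b : ℕ) :
    listSum (a + (k + 2) + b) (fun l => chainInd A l * neInd A l[a]? l[a + (k + 1)]? *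
      (l.map x).prod) = hatSum x a k b := by
  rw [show a + (k + 2) + b = a + (k + (b + 1) + 1) by ring, listSum_add]
  have key : ∀ l₁ : List C, l₁.length = a → ∀ c, ∀ l₂ : List C, l₂.length = k → ∀ d l₃,
      chainInd A (l₁ ++ c :: (l₂ ++ d :: l₃)) * neInd A (l₁ ++ c :: (l₂ ++ d :: l₃))[a]?
        (l₁ ++ c :: (l₂ ++ d :: l₃))[a + (k + 1)]? *
        ((l₁ ++ c :: (l₂ ++ d :: l₃)).map x).prod =
      (chainInd A (l₁ ++ [c]) * (l₁.map x).prod) * ((neInd A c d * x c * x d) *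
        ((chainInd A (c :: (l₂ ++ [d])) * (l₂.map x).prod) *
          (chainInd A (d :: l₃) * (l₃.map x).prod))) := by
    rintro l₁ rfl c l₂ rfl d l₃
    rw [List.getElem?_append_right le_rfl, List.getElem?_append_right (by omega),
      Nat.sub_self, Nat.add_sub_cancel_left, List.getElem?_cons_zero, List.getElem?_cons_succ,
      List.getElem?_append_right le_rfl, Nat.sub_self, List.getElem?_cons_zero,
      chainInd_append_cons, ← List.cons_append, chainInd_append_cons (c :: l₂)]
    have : neInd A (some c) (some d) = neInd A c d := by simp [neInd]
    rw [this]
    simp only [List.map_append, List.map_cons, List.prod_append, List.prod_cons, List.cons_append]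
    ring
  calc _ = listSum a fun l₁ => ∑ c, ∑ d, (chainInd A (l₁ ++ [c]) * (l₁.map x).prod) *
        ((neInd A c d * x c * x d) * (between x k c d * pathAvoid x b d)) := by
        refine listSum_congr fun l₁ h₁ => sum_congr rfl fun c _ => ?_
        rw [listSum_add]
        simp only [listSum]
        rw [listSum_sum]
        refine sum_congr rfl fun d _ => ?_
        rw [← listSum_chainInd_between, ← listSum_chainInd_cons, ← listSum_mul_right,
          ← listSum_mul_left, ← listSum_mul_left]
        refine listSum_congr fun l₂ h₂ => ?_
        rw [← listSum_mul_left, ← listSum_mul_left, ← listSum_mul_left]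
        exact listSum_congr fun l₃ _ => key l₁ h₁ c l₂ h₂ d l₃
    _ = _ := by
        rw [listSum_sum, hatSum]
        refine sum_congr rfl fun c _ => ?_
        rw [listSum_sum]
        refine sum_congr rfl fun d _ => ?_
        rw [listSum_mul_right, listSum_chainInd_append]
        ring

theorem sum_hat_colorings (a k b : ℕ) (hm : 2 ≤ k + 2)
    [∀ κ : Fin (a + (k + 2) + b) → C, Decidable (∀ u v, (hat a (k + 2) b hm).Adj u v → κ u ≠ κ v)] :
    ∑ κ : Fin (a + (k + 2) + b) → C,
      (if ∀ u v, (hat a (k + 2) b hm).Adj u v → κ u ≠ κ v then ∏ v, x (κ v) else 0) =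
    hatSum x a k b := by
  rw [← listSum_hat, ← sum_ofFn_eq_listSum]
  refine sum_congr rfl fun κ _ => ?_
  have h1 : (∀ u v, (hat a (k + 2) b hm).Adj u v → κ u ≠ κ v) ↔
      (List.ofFn κ).IsChain (· ≠ ·) ∧ (List.ofFn κ)[a]? ≠ (List.ofFn κ)[a + (k + 1)]? := by
    rw [List.isChain_ofFn, List.getElem?_ofFn, List.getElem?_ofFn, dif_pos (by omega),
      dif_pos (by omega), Ne, Option.some_inj]
    constructor
    · intro hκ
      refine ⟨fun i hi => hκ _ _ ?_, hκ _ _ ?_⟩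
      · exact Or.inl (SimpleGraph.pathGraph_adj.mpr (Or.inl rfl))
      · refine Or.inr ((SimpleGraph.edge_adj ..).mpr ⟨Or.inl ⟨rfl, rfl⟩, ?_⟩)
        simp
    · rintro ⟨hp, he⟩ u v (huv | huv)
      · rcases SimpleGraph.pathGraph_adj.mp huv with h | h
        · have := hp u.1 (by omega)
          simpa [h] using this
        · have := hp v.1 (by omega)
          simpa [h, eq_comm] using this
      · rcases ((SimpleGraph.edge_adj ..).mp huv).1 with ⟨rfl, rfl⟩ | ⟨rfl, rfl⟩
        · exact he
        · exact fun h => he h.symm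
  rw [List.map_ofFn, List.prod_ofFn]
  simp only [chainInd, neInd, h1, Function.comp]
  split_ifs <;> simp_all

end ListSums

/-! ### Reduction to finitely many colours -/

section FiniteColours

theorem prod_X_eq_monomial {ι : Type*} (s : Finset ι) (f : ι → ℕ) :
    ∏ i ∈ s, (MvPowerSeries.X (f i) : MvPowerSeries ℕ ℚ) =
      MvPowerSeries.monomial (∑ i ∈ s, Finsupp.single (f i) 1) 1 := by
  simp only [MvPowerSeries.X_def, MvPowerSeries.prod_monomial, prod_const_one]

theorem mem_support_sum_single {ι : Type*} {s : Finset ι} (f : ι → ℕ) {i : ι} (hi : i ∈ s) :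
    f i ∈ (∑ i ∈ s, Finsupp.single (f i) 1 : ℕ →₀ ℕ).support := by
  rw [Finsupp.mem_support_iff, Finsupp.finsetSum_apply]
  intro h
  simpa using sum_eq_zero_iff.mp h i hi

open Classical in
theorem coeff_chromaticSymm {V : Type*} [Fintype V] [DecidableEq V] (G : SimpleGraph V)
    (d : ℕ →₀ ℕ) :
    MvPowerSeries.coeff d (chromaticSymm G) = MvPowerSeries.coeff d
      (∑ κ : V → d.support, if ∀ u v, G.Adj u v → κ u ≠ κ v then
        ∏ v, (MvPowerSeries.X (κ v : ℕ) : MvPowerSeries ℕ ℚ) else 0) := by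
  have h1 : ∀ κ : V → d.support, MvPowerSeries.coeff d
      (if ∀ u v, G.Adj u v → κ u ≠ κ v then
        ∏ v, (MvPowerSeries.X (κ v : ℕ) : MvPowerSeries ℕ ℚ) else 0) =
      if (∀ u v, G.Adj u v → κ u ≠ κ v) ∧ ∑ v, Finsupp.single (κ v : ℕ) 1 = d
        then 1 else 0 := by
    intro κ
    rw [prod_X_eq_monomial, ite_and]
    split_ifs with h2 h3
    · rw [h3, MvPowerSeries.coeff_monomial_same]
    · rw [MvPowerSeries.coeff_monomial_ne (Ne.symm h3)]
    · rw [map_zero]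
  rw [map_sum, sum_congr rfl fun κ _ => h1 κ, sum_boole, ← Fintype.card_subtype,
    ← Nat.card_eq_fintype_card]
  change ((Nat.card _ : ℕ) : ℚ) = _
  congr 1
  refine Nat.card_congr
    { toFun := fun κ => ⟨fun v => ⟨κ.1 v, ?_⟩, ?_, ?_⟩
      invFun := fun κ => ⟨SimpleGraph.Coloring.mk (fun v => (κ.1 v : ℕ)) ?_, ?_⟩
      left_inv := ?_
      right_inv := ?_ }
  · obtain ⟨κ, rfl⟩ := κ
    exact mem_support_sum_single κ (mem_univ v)
  · intro u v huv h
    exact κ.1.valid huv (congrArg Subtype.val h)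
  · exact κ.2
  · intro u v huv h
    exact κ.2.1 u v huv (Subtype.ext h)
  · exact κ.2.2
  · intro κ; rfl
  · intro κ; rfl

/-- The elementary symmetric function `e_k` in the indeterminates of `S`. -/
noncomputable def elemSymmOn (k : ℕ) (S : Finset ℕ) : MvPowerSeries ℕ ℚ :=
  PowerSeries.coeff k (∏ c : S, (1 + PowerSeries.C (MvPowerSeries.X c.1) * PowerSeries.X))

theorem elemSymmOn_eq (k : ℕ) (S : Finset ℕ) :
    elemSymmOn k S = ∑ t ∈ S.powersetCard k, MvPowerSeries.monomial (subsetMonomial t) 1 := by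
  rw [elemSymmOn, prod_coe_sort S fun c =>
    (1 + PowerSeries.C (MvPowerSeries.X c : MvPowerSeries ℕ ℚ) * PowerSeries.X), prod_one_add,
    map_sum, powersetCard_eq_filter, sum_filter]
  refine sum_congr rfl fun t _ => ?_
  rw [prod_mul_distrib, prod_const, ← map_prod, PowerSeries.coeff_C_mul_X_pow,
    prod_X_eq_monomial]
  exact if_congr eq_comm rfl rfl

theorem coeff_elemSymm {S : Finset ℕ} {d : ℕ →₀ ℕ} (hd : d.support ⊆ S) (k : ℕ) :
    MvPowerSeries.coeff d (elemSymm k) = MvPowerSeries.coeff d (elemSymmOn k S) := by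
  classical
  simp only [elemSymmOn_eq, map_sum, MvPowerSeries.coeff_monomial, sum_boole]
  rw [← Fintype.card_coe, ← Nat.card_eq_fintype_card]
  change ((Nat.card _ : ℕ) : ℚ) = _
  congr 1
  refine Nat.card_congr
    { toFun := fun s => ⟨s.1.1, ?_⟩
      invFun := fun t => ⟨⟨t.1, ?_⟩, ?_⟩
      left_inv := fun s => rfl
      right_inv := fun t => rfl }
  · obtain ⟨⟨s, hs⟩, rfl⟩ := s
    refine mem_filter.mpr ⟨mem_powersetCard.mpr ⟨fun i hi => hd ?_, hs⟩, rfl⟩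
    exact mem_support_sum_single (fun i => i) hi
  · exact (mem_powersetCard.mp (mem_filter.mp t.2).1).2
  · exact (mem_filter.mp t.2).2.symm

theorem coeff_prod_elemSymm {S : Finset ℕ} (s : Multiset ℕ) {d : ℕ →₀ ℕ} (hd : d.support ⊆ S) :
    MvPowerSeries.coeff d (s.map elemSymm).prod =
      MvPowerSeries.coeff d (s.map fun k => elemSymmOn k S).prod := by
  classical
  induction s using Multiset.induction_on generalizing d with
  | empty => rfl
  | cons k s ih =>
    rw [Multiset.map_cons, Multiset.prod_cons, Multiset.map_cons, Multiset.prod_cons,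
      MvPowerSeries.coeff_mul, MvPowerSeries.coeff_mul]
    refine sum_congr rfl fun p hp => ?_
    have hp := HasAntidiagonal.mem_antidiagonal.mp hp
    rw [coeff_elemSymm ((Finsupp.support_mono (hp ▸ le_self_add)).trans hd),
      ih ((Finsupp.support_mono (hp ▸ le_add_self)).trans hd)]

/-- The weights of the colours of `S` by their indeterminates. -/
noncomputable def colourWeight (S : Finset ℕ) (c : S) : MvPowerSeries ℕ ℚ :=
  MvPowerSeries.X c.1

/-- Taking A to be the functions of the colour set S makes one family of coefficients c_λ serve all
S at once. -/
theorem hatRelations_colours : HatRelations (A := Finset ℕ → MvPowerSeries ℕ ℚ) elemSymmOn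
    (fun n S => pathSum (colourWeight S) n) (fun a b c S => spiderSum (colourWeight S) a b c)
    (fun a k b S => hatSum (colourWeight S) a k b) where
  gen_zero := by
    funext S
    simp [elemSymmOn, PowerSeries.coeff_zero_eq_constantCoeff, map_prod]
  path n := by
    funext S
    have h := congrArg (PowerSeries.coeff n) (pathSeries_mul (colourWeight S))
    rw [PowerSeries.coeff_mul] at h
    rw [Finset.sum_apply]
    refine Eq.trans (sum_congr rfl fun p _ => ?_) h
    simp only [map_sub, coeff_euler, PowerSeries.coeff_mk, Pi.mul_apply, Pi.sub_apply, Pi.one_apply,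
      Pi.natCast_apply, elemSymmOn, colourWeight]
    ring
  spider_zero a c := funext fun S => spiderSum_zero (colourWeight S) a c
  spider_succ a b c := funext fun S => spiderSum_succ (colourWeight S) a b c
  hat_comm a k b := funext fun S => hatSum_comm (colourWeight S) a k b
  hat_zero_zero b := funext fun S => hatSum_zero_zero (colourWeight S) b
  hat_succ a k b := funext fun S => hatSum_succ (colourWeight S) a k b

end FiniteColours

theorem mainTheorem1 (a m b : ℕ) (hm : 2 ≤ m) : (hat a m b hm).IsEPositive := by
  classical
  obtain ⟨k, rfl⟩ : ∃ k, m = k + 2 := ⟨m - 2, by omega⟩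
  obtain ⟨c, hc, hc0⟩ := (hatRelations_colours.ePos_hat a k b).exists_partition
  rw [SimpleGraph.IsEPositive, Fintype.card_fin]
  refine ⟨c, ?_, hc0⟩
  ext d
  -- Colours outside the support of d cannot contribute to the coefficient at d, so S = `d.support`
  -- suffices.
  have h1 := congrArg (MvPowerSeries.coeff d) (congrFun hc d.support)
  rw [← sum_hat_colorings (colourWeight d.support) a k b hm] at h1
  rw [coeff_chromaticSymm]
  refine Eq.trans ?_ (h1.trans ?_)
  · refine congrArg _ (sum_congr rfl fun κ _ => ?_)
    split_ifs <;> rfl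
  · rw [Finset.sum_apply, map_sum, map_sum]
    refine sum_congr rfl fun lam _ => ?_
    have h2 : (lam.parts.map elemSymmOn).prod d.support =
        (lam.parts.map fun k => elemSymmOn k d.support).prod := by
      have := map_multiset_prod (Pi.evalRingHom (fun _ : Finset ℕ => MvPowerSeries ℕ ℚ) d.support)
        (lam.parts.map elemSymmOn)
      rwa [Multiset.map_map] at this
    rw [Pi.smul_apply, h2, MvPowerSeries.coeff_smul, MvPowerSeries.coeff_smul, elemSymmPart,
      coeff_prod_elemSymm lam.parts subset_rfl]
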